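/- Let $k\ge 2$, let $F$ be a field with $2^k$ elements and let $G=PSL(2,F)=PSL(2,2^k)$. The co-centralizer graph of $G$ is the simple graph whose vertices are the distinct proper subgroups of $G$ of the form $C_G(x)=\{g\in G: gx=xg\}$, $x\in G$, two distinct vertices being adjacent if and only if their cardinalities differ (it is the complement of the centralizer graph, in which distinct vertices are adjacent if and only if their cardinalities are equal). For a finite connected graph $H$ let $D(H)$ be the matrix of distances between vertices, let $Tr(H)$ be the diagonal matrix of the row sums of $D(H)$, and let the distance Laplacian spectrum of $H$ be the multiset of zeros of the characteristic polynomial of $D^L(H)=Tr(H)-D(H)$; $H$ is distance Laplacian integral if this spectrum consists of integers. The co-centralizer graph of $PSL(2,2^k)$ is isomorphic to the complete tripartite graph $K_{2^k+1,\;2^{k-1}(2^k+1),\;2^{k-1}(2^k-1)}$. Its distance Laplacian spectrum consists exactly of the following pairwise distinct eigenvalues: (a) $0$ with multiplicity $1$; (b) $3\cdot 2^{2k-1}+3\cdot 2^{k-1}+1$ with multiplicity $2^{k-1}(2^k+1)-1$; (c) $3\cdot 2^{2k-1}+2^{k-1}+1$ with multiplicity $2^{k-1}(2^k-1)-1$;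 (d) $2^{2k}+2^{k+1}+2$ with multiplicity $2^k$; (e) $2^{2k}+2^k+1$ with multiplicity $2$. In particular, this graph is distance Laplacian integral. -/

import Mathlib

/-- The proper centralizers of `G`: the subgroups `C_G(x)`, `x ∈ G`, that are different from `G`
(each subgroup counted once). -/
abbrev ProperCentralizer (G : Type*) [Group G] : Type _ :=
  {H : Subgroup G // H ≠ ⊤ ∧ ∃ x : G, H = Subgroup.centralizer {x}}

noncomputable instance ProperCentralizer.instFintype (G : Type*) [Group G] [Finite G] :
    Fintype (ProperCentralizer G) := Fintype.ofFinite _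

noncomputable instance ProperCentralizer.instDecidableEq (G : Type*) [Group G] :
    DecidableEq (ProperCentralizer G) := Classical.decEq _

/-- The centralizer graph: two distinct proper centralizers are adjacent iff they have the same
cardinality. -/
def centralizerGraph (G : Type*) [Group G] : SimpleGraph (ProperCentralizer G) where
  Adj H K := H ≠ K ∧ Nat.card H.1 = Nat.card K.1
  symm := ⟨fun _ _ h => ⟨h.1.symm, h.2.symm⟩⟩
  loopless := ⟨fun _ h => h.1 rfl⟩

/-- The co-centralizer graph: the complement of the centralizer graph. -/
def coCentralizerGraph (G : Type*) [Group G] : SimpleGraph (ProperCentralizer G) :=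
  (centralizerGraph G)ᶜ

namespace SimpleGraph

variable {V : Type*} (H : SimpleGraph V)

/-- The distance matrix. -/
noncomputable def distMatrix : Matrix V V ℝ :=
  Matrix.of fun u v => (H.dist u v : ℝ)

/-- The transmission of a vertex. -/
noncomputable def transmission [Fintype V] (v : V) : ℕ :=
  ∑ u, H.dist v u

/-- The distance Laplacian matrix `Tr(H) - D(H)`. -/
noncomputable def distLaplacian [Fintype V] [DecidableEq V] : Matrix V V ℝ :=
  Matrix.diagonal (fun v => (H.transmission v : ℝ)) - H.distMatrix

/-- The distance Laplacian spectrum: the multiset of the zeros of the characteristic polynomial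
of the distance Laplacian matrix, with multiplicity. -/
noncomputable def distLaplacianSpectrum [Fintype V] [DecidableEq V] : Multiset ℝ :=
  H.distLaplacian.charpoly.roots

/-- All distance Laplacian eigenvalues are integers. -/
def IsDistLaplacianIntegral [Fintype V] [DecidableEq V] : Prop :=
  ∀ μ ∈ H.distLaplacianSpectrum, ∃ z : ℤ, μ = z

end SimpleGraph

/-! Write q = 2^k. In characteristic two the centre of SL₂ is trivial, so PSL₂ is SL₂. Modulo
scalars the 2×2 matrices form a three-dimensional space, and two matrices commute exactly when their
classes are parallel. As q > 2, every direction contains an element of SL₂, so the proper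
centralizers are the q² + q + 1 points of the projective plane (`exists_equiv_properCentralizer`).

The centralizer of x is the norm-one group of the quadratic algebra F[x]. Its order is q, q - 1 or q
+ 1 according as the algebra is inseparable (trace zero), split or a field (`card_centralizer_eq`).
Counting the points of each kind gives the three parts.

For parts of sizes n_i and N vertices, the distance Laplacian is the diagonal matrix with entries N
+ n_i minus a matrix of rank at most 3, so its characteristic polynomial reduces to a 3×3
determinant (`distLaplacianSpectrum_of_adj_iff_ne`). -/

/-! ### Distance Laplacian of complete tripartite graphs. -/

namespace SimpleGraph

variable {V : Type*} {ι : Type*} [DecidableEq ι] {H : SimpleGraph V} {τ : V → ι}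

/-- Distances in a complete multipartite graph with at least two parts. -/
theorem dist_eq_of_adj_iff_ne [DecidableEq V] [Nontrivial ι]
    (hadj : ∀ u v, H.Adj u v ↔ τ u ≠ τ v) (hτ : Function.Surjective τ) (u v : V) :
    (H.dist u v : ℝ) = 1 + (if τ u = τ v then 1 else 0) - (if u = v then 2 else 0) := by
  by_cases huv : u = v
  · subst huv
    norm_num
  by_cases h : τ u = τ v
  · obtain ⟨i, hi⟩ := exists_ne (τ u)
    obtain ⟨w, rfl⟩ := hτ i
    have h1 : H.Adj u w := (hadj u w).2 hi.symm
    have h2 : H.Adj w v := (hadj w v).2 (h ▸ hi)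
    have hle : H.dist u v ≤ 2 := dist_le (Walk.cons h1 (Walk.cons h2 Walk.nil))
    have h0 : H.dist u v ≠ 0 := fun h0 =>
      huv ((Reachable.dist_eq_zero_iff (h1.reachable.trans h2.reachable)).1 h0)
    have h1' : H.dist u v ≠ 1 := fun h1' => ((hadj u v).1 (dist_eq_one_iff_adj.1 h1')) h
    have : H.dist u v = 2 := by omega
    rw [this]
    simp [huv, h]
    norm_num
  · rw [dist_eq_one_iff_adj.2 ((hadj u v).2 h)]
    simp [huv, h]

theorem distLaplacian_apply_of_adj_iff_ne [Fintype V] [DecidableEq V] [Nontrivial ι]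
    (hadj : ∀ u v, H.Adj u v ↔ τ u ≠ τ v) (hτ : Function.Surjective τ) (u v : V) :
    H.distLaplacian u v =
      (if u = v then (Fintype.card V + Fintype.card {w // τ w = τ u} : ℝ) else 0)
        - (1 + if τ u = τ v then 1 else 0) := by
  have htr : (H.transmission u : ℝ) = Fintype.card V + Fintype.card {w // τ w = τ u} - 2 := by
    unfold transmission
    push_cast
    simp_rw [dist_eq_of_adj_iff_ne hadj hτ]
    rw [Finset.sum_sub_distrib, Finset.sum_add_distrib, Fintype.card_subtype]
    simp [eq_comm]
  rw [distLaplacian, Matrix.sub_apply, Matrix.diagonal_apply, htr, distMatrix, Matrix.of_apply,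
    dist_eq_of_adj_iff_ne hadj hτ]
  split_ifs <;> ring

/-- The determinant of a diagonal matrix, constant on the fibres of `τ`, plus the sum of the
all-ones matrix and of the block-all-ones matrix. -/
theorem det_diagonal_add_blocks [Fintype V] [DecidableEq V] [Fintype ι]
    (d : ι → ℝ) (hd : ∀ i, d i ≠ 0) :
    (Matrix.of fun u v : V => (if u = v then d (τ u) else 0) + (1 + if τ u = τ v then 1 else 0)).det
      = (∏ i, d i ^ Fintype.card {v // τ v = i}) *
        (1 + Matrix.of fun i j : ι =>
          (1 + if i = j then 1 else 0) * (Fintype.card {v // τ v = j} / d j)).det := by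
  -- The matrix factors as D(1 + AB) with AB passing through the index set of the parts; det(1 + AB)
  -- = det(1 + BA) then shrinks the determinant.
  set D : Matrix V V ℝ := Matrix.diagonal fun v => d (τ v) with hD
  set A : Matrix V ι ℝ := Matrix.of fun v i => if τ v = i then (d i)⁻¹ else 0 with hA
  set B : Matrix ι V ℝ := Matrix.of fun i v => 1 + if i = τ v then 1 else 0 with hB
  have h1 : (Matrix.of fun u v : V =>
      (if u = v then d (τ u) else 0) + (1 + if τ u = τ v then (1 : ℝ) else 0)) = D * (1 + A * B) := by
    ext u v
    rw [hD, Matrix.diagonal_mul, Matrix.add_apply, Matrix.mul_apply, Matrix.one_apply]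
    simp only [hA, hB, Matrix.of_apply, ite_mul, zero_mul, Finset.sum_ite_eq, Finset.mem_univ,
      if_true]
    have := hd (τ u)
    rw [mul_add, mul_inv_cancel_left₀ this]
    simp
  have h2 : B * A = Matrix.of fun i j : ι =>
          (1 + if i = j then 1 else 0) * (Fintype.card {v // τ v = j} / d j : ℝ) := by
    ext i j
    rw [Matrix.mul_apply, Matrix.of_apply, Fintype.card_subtype, div_eq_mul_inv,
      Finset.card_eq_sum_ones, Finset.sum_filter]
    push_cast
    rw [Finset.sum_mul, Finset.mul_sum]
    refine Finset.sum_congr rfl fun v _ => ?_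
    simp only [hA, hB, Matrix.of_apply]
    by_cases h : τ v = j
    · subst h; simp
    · simp [h]
  rw [h1, Matrix.det_mul, Matrix.det_one_add_mul_comm, h2, hD, Matrix.det_diagonal]
  congr 1
  rw [← Finset.prod_fiberwise (s := Finset.univ) (g := τ)]
  refine Finset.prod_congr rfl fun i _ => ?_
  rw [Fintype.card_subtype, Finset.prod_congr rfl (g := fun _ => d i), Finset.prod_const]
  intro v hv
  rw [(Finset.mem_filter.1 hv).2]

/-- Scaling column j by y - a j leaves y times the identity plus a matrix of rank one with all rows
equal to a. With y = x - (a 0 + a 1 + a 2), the right side yields the eigenvalue 0 once and the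
number of vertices twice. -/
theorem det_one_add_blocks_fin_three (a : Fin 3 → ℝ) (y : ℝ) (h : ∀ i, y - a i ≠ 0) :
    (∏ i, (y - a i)) *
      (1 + Matrix.of fun i j => (1 + if i = j then 1 else 0) * (a j / (y - a j))).det =
      (y + (a 0 + a 1 + a 2)) * y ^ 2 := by
  have h0 := h 0
  have h1 := h 1
  have h2 := h 2
  simp only [Fin.prod_univ_three, Matrix.det_fin_three, Matrix.add_apply, Matrix.of_apply,
    Matrix.one_apply]
  simp
  field_simp
  ring

/-- The distance Laplacian spectrum of a complete tripartite graph. -/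
theorem distLaplacianSpectrum_of_adj_iff_ne {τ : V → Fin 3} [Fintype V] [DecidableEq V]
    (hadj : ∀ u v, H.Adj u v ↔ τ u ≠ τ v) (hτ : Function.Surjective τ)
    {n : Fin 3 → ℕ} (hn : ∀ i, Fintype.card {v // τ v = i} = n i) :
    H.distLaplacianSpectrum =
      Multiset.replicate 1 0 +
      Multiset.replicate (n 1 - 1) (n 0 + n 1 + n 2 + n 1 : ℝ) +
      Multiset.replicate (n 2 - 1) (n 0 + n 1 + n 2 + n 2 : ℝ) +
      Multiset.replicate (n 0 - 1) (n 0 + n 1 + n 2 + n 0 : ℝ) +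
      Multiset.replicate 2 (n 0 + n 1 + n 2 : ℝ) := by
  have hV : (Fintype.card V : ℝ) = n 0 + n 1 + n 2 := by
    rw [← Fintype.card_congr (Equiv.sigmaFiberEquiv τ), Fintype.card_sigma, Fin.sum_univ_three]
    simp only [hn]
    push_cast
    ring
  have hpos : ∀ i, n i ≠ 0 := fun i => by
    obtain ⟨v, hv⟩ := hτ i
    exact hn i ▸ (Fintype.card_pos_iff.2 ⟨⟨v, hv⟩⟩).ne'
  set s := (n 0 + n 1 + n 2 : ℝ) with hs
  set S : Multiset ℝ := Multiset.replicate 1 0 +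
      Multiset.replicate (n 1 - 1) (s + n 1) + Multiset.replicate (n 2 - 1) (s + n 2) +
      Multiset.replicate (n 0 - 1) (s + n 0) + Multiset.replicate 2 s
  suffices hp : H.distLaplacian.charpoly = (S.map fun a => Polynomial.X - Polynomial.C a).prod by
    rw [distLaplacianSpectrum, hp, Polynomial.roots_multiset_prod_X_sub_C]
  -- The diagonal part must be invertible, so the polynomials are compared away from the three
  -- values s + n i.
  refine Polynomial.eq_of_infinite_eval_eq _ _ (Set.Infinite.mono (s := {s + n 0, s + n 1, s + n 2}ᶜ)
    (fun x hx => ?_) (Set.Finite.infinite_compl (by simp)))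
  simp only [Set.mem_compl_iff, Set.mem_insert_iff, Set.mem_singleton_iff, not_or] at hx
  obtain ⟨hx0, hx1, hx2⟩ := hx
  have hd : ∀ i, x - (s + n i) ≠ 0 := by
    intro i
    fin_cases i <;> simpa [sub_eq_zero]
  have hM : Matrix.scalar V x - H.distLaplacian = Matrix.of fun u v : V =>
      (if u = v then x - (s + n (τ u)) else 0) + (1 + if τ u = τ v then 1 else 0) := by
    ext u v
    rw [Matrix.sub_apply, distLaplacian_apply_of_adj_iff_ne hadj hτ, Matrix.of_apply, hn, hV,
      Matrix.scalar_apply, Matrix.diagonal_apply]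
    split_ifs <;> ring
  rw [Set.mem_ofPred_eq, Matrix.eval_charpoly, hM,
    det_diagonal_add_blocks (fun i => x - (s + n i)) hd]
  simp only [hn]
  have hdet := det_one_add_blocks_fin_three (fun i => (n i : ℝ)) (x - s)
    (fun i => by simpa [sub_sub] using hd i)
  simp only [S, Multiset.map_add, Multiset.map_replicate, Multiset.prod_add,
    Multiset.prod_replicate, Polynomial.eval_mul, Polynomial.eval_pow, Polynomial.eval_sub,
    Polynomial.eval_X, Polynomial.eval_C, Fin.prod_univ_three, sub_zero, pow_one]
  simp only [Fin.prod_univ_three, ← hs, sub_add_cancel, sub_sub] at hdet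
  have hpow : ∀ i, (x - (s + n i)) ^ n i = (x - (s + n i)) ^ (n i - 1) * (x - (s + n i)) :=
    fun i => (pow_sub_one_mul (hpos i) _).symm
  rw [hpow 0, hpow 1, hpow 2]
  linear_combination (x - (s + n 0)) ^ (n 0 - 1) * (x - (s + n 1)) ^ (n 1 - 1) *
    (x - (s + n 2)) ^ (n 2 - 1) * hdet

end SimpleGraph

/-! ### Norm-one counts for binary quadratic forms in characteristic two. -/

section CharTwo

variable {F : Type*} [Field F] [CharP F 2]

theorem exists_sq_eq_of_charTwo [Fintype F] (a : F) : ∃ b : F, b ^ 2 = a := by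
  obtain ⟨b, hb⟩ := FiniteField.isSquare_of_char_two (ringChar.eq F 2) a
  exact ⟨b, by rw [hb, sq]⟩

theorem sq_inj_of_charTwo {a b : F} (h : a ^ 2 = b ^ 2) : a = b := by
  have h2 : (2 : F) = 0 := CharTwo.two_eq_zero
  have : (a - b) ^ 2 = 0 := by linear_combination h + (b ^ 2 - a * b) * h2
  exact sub_eq_zero.1 (pow_eq_zero_iff two_ne_zero |>.1 this)

/-- With d = e², the form is the square of a + s e, so each s determines a. -/
theorem card_inseparable_norm_one [Fintype F] (d : F) :
    Nat.card {v : F × F // v.1 ^ 2 + v.2 ^ 2 * d = 1} = Nat.card F := by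
  obtain ⟨e, rfl⟩ := exists_sq_eq_of_charTwo d
  have h2 : (2 : F) = 0 := CharTwo.two_eq_zero
  refine Nat.card_congr
    ⟨fun v => v.1.2, fun s => ⟨(1 - s * e, s), ?_⟩, fun v => ?_, fun s => rfl⟩
  · linear_combination (s ^ 2 * e ^ 2 - s * e) * h2
  · obtain ⟨⟨a, s⟩, h⟩ := v
    refine Subtype.ext (Prod.ext ?_ rfl)
    refine sq_inj_of_charTwo ?_
    simp only at h ⊢
    linear_combination -h + (s ^ 2 * e ^ 2 - s * e) * h2

/-- The form factors as (a + r s)(a + (r + 1) s), so the solutions are the pairs of a unit and its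
inverse. -/
theorem card_split_norm_one (r : F) :
    Nat.card {v : F × F // v.1 ^ 2 + v.1 * v.2 + v.2 ^ 2 * (r ^ 2 + r) = 1} = Nat.card F - 1 := by
  have h2 : (2 : F) = 0 := CharTwo.two_eq_zero
  rw [← Nat.card_units]
  refine Nat.card_congr (Equiv.ofBijective
    (fun v => ⟨v.1.1 + r * v.1.2, v.1.1 + (r + 1) * v.1.2, ?_, ?_⟩) ⟨?_, ?_⟩)
  · linear_combination v.2 + r * v.1.1 * v.1.2 * h2
  · linear_combination v.2 + r * v.1.1 * v.1.2 * h2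
  · rintro ⟨⟨a, s⟩, h⟩ ⟨⟨a', s'⟩, h'⟩ heq
    have e1 : a + r * s = a' + r * s' := congrArg Units.val heq
    have e2 : a + (r + 1) * s = a' + (r + 1) * s' := congrArg (fun u : Fˣ => (↑u⁻¹ : F)) heq
    have e3 : s = s' := by linear_combination e2 - e1
    subst e3
    have e4 : a = a' := by linear_combination e1
    subst e4
    rfl
  · intro u
    have hu : (u : F) * (↑u⁻¹ : F) = 1 := u.mul_inv
    refine ⟨⟨(u - r * (↑u⁻¹ - u), ↑u⁻¹ - u), ?_⟩, ?_⟩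
    · simp only
      linear_combination hu + r * (↑u⁻¹ - u) * (r * (↑u⁻¹ - u) - u) * h2
    · ext
      simp

/-- The form has no nontrivial zero and squaring is bijective, so each nonzero vector is uniquely a
unit times a norm-one vector; divide q² - 1 by q - 1. -/
theorem card_anisotropic_norm_one [Fintype F] (d : F) (hd : ∀ r : F, r ^ 2 + r ≠ d) :
    Nat.card {v : F × F // v.1 ^ 2 + v.1 * v.2 + v.2 ^ 2 * d = 1} = Nat.card F + 1 := by
  have h2 : (2 : F) = 0 := CharTwo.two_eq_zero
  have hN : ∀ v : F × F, v ≠ 0 → v.1 ^ 2 + v.1 * v.2 + v.2 ^ 2 * d ≠ 0 := by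
    rintro ⟨a, s⟩ hv h
    simp only at h
    by_cases hs : s = 0
    · subst hs
      refine hv (Prod.ext ?_ rfl)
      simpa using h
    · refine hd (a / s) ?_
      field_simp
      linear_combination h - s ^ 2 * d * h2
  have key : Nat.card (Fˣ × {v : F × F // v.1 ^ 2 + v.1 * v.2 + v.2 ^ 2 * d = 1}) =
      Nat.card {v : F × F // v ≠ 0} := by
    refine Nat.card_congr (Equiv.ofBijective (fun p => ⟨(p.1 : F) • p.2.1, ?_⟩) ⟨?_, ?_⟩)
    · obtain ⟨u, ⟨v, hv⟩⟩ := p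
      refine smul_ne_zero u.ne_zero ?_
      rintro rfl
      simp at hv
    · rintro ⟨u, ⟨⟨a, s⟩, h⟩⟩ ⟨u', ⟨⟨a', s'⟩, h'⟩⟩ heq
      simp only [Subtype.mk.injEq, Prod.smul_mk, smul_eq_mul, Prod.mk.injEq] at heq
      obtain ⟨e1, e2⟩ := heq
      simp only at h h'
      have hu : (u : F) = u' := by
        refine sq_inj_of_charTwo ?_
        calc (u : F) ^ 2 = (u * a) ^ 2 + (u * a) * (u * s) + (u * s) ^ 2 * d := by
              linear_combination -(u : F) ^ 2 * h
          _ = (u' : F) ^ 2 := by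
              rw [e1, e2]
              linear_combination (u' : F) ^ 2 * h'
      have hu' : u = u' := Units.ext hu
      subst hu'
      have ha := mul_left_cancel₀ u.ne_zero e1
      have hs := mul_left_cancel₀ u.ne_zero e2
      subst ha hs
      rfl
    · rintro ⟨⟨a, s⟩, hv⟩
      obtain ⟨u, hu⟩ := exists_sq_eq_of_charTwo (a ^ 2 + a * s + s ^ 2 * d)
      have hu0 : u ≠ 0 := by
        rintro rfl
        exact hN (a, s) hv (by simpa using hu.symm)
      refine ⟨⟨Units.mk0 u hu0, ⟨(a / u, s / u), ?_⟩⟩, ?_⟩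
      · simp only
        field_simp
        rw [hu]
        ring
      · refine Subtype.ext (Prod.ext ?_ ?_)
        · simp [mul_div_cancel₀ _ hu0]
        · simp [mul_div_cancel₀ _ hu0]
  classical
  rw [Nat.card_prod, Nat.card_units] at key
  have hne : Nat.card {v : F × F // v ≠ 0} = Nat.card F * Nat.card F - 1 := by
    rw [Nat.card_eq_fintype_card, Fintype.card_subtype_compl, Fintype.card_prod]
    simp
  have hq : 1 < Nat.card F := by
    rw [Nat.card_eq_fintype_card]
    exact Fintype.one_lt_card
  obtain ⟨m, hm⟩ : ∃ m, Nat.card F = m + 2 := ⟨Nat.card F - 2, by omega⟩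
  rw [hne, hm] at key
  rw [hm]
  have : (m + 1) * Nat.card {v : F × F // v.1 ^ 2 + v.1 * v.2 + v.2 ^ 2 * d = 1} =
      (m + 1) * (m + 3) := by
    have e : (m + 2) * (m + 2) - 1 = (m + 1) * (m + 3) := by
      rw [Nat.sub_eq_iff_eq_add (by nlinarith)]
      ring
    rw [← e, ← key]
    rfl
  exact Nat.eq_of_mul_eq_mul_left (Nat.succ_pos m) this

/-- Twice the number of pairs whose product has the form `r ^ 2 + r`. -/
theorem two_mul_card_mul_eq_sq_add_self [Fintype F] :
    2 * Nat.card {p : F × F // ∃ r : F, r ^ 2 + r = p.1 * p.2} =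
      Nat.card F * (Nat.card F + 1) := by
  classical
  have h2 : (2 : F) = 0 := CharTwo.two_eq_zero
  have hroots : ∀ r : F, Finset.univ.filter (fun x : F => x ^ 2 + x = r ^ 2 + r) = {r, r + 1} := by
    intro r
    ext x
    simp only [Finset.mem_filter, Finset.mem_univ, true_and, Finset.mem_insert,
      Finset.mem_singleton]
    constructor
    · intro h
      have : (x - r) * (x - (r + 1)) = 0 := by linear_combination h + (r ^ 2 + r - x * r - x) * h2
      rcases mul_eq_zero.1 this with h | h
      · exact Or.inl (sub_eq_zero.1 h)
      · exact Or.inr (sub_eq_zero.1 h)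
    · rintro (rfl | rfl)
      · rfl
      · linear_combination (r + 1) * h2
  have hroots_card : ∀ r : F,
      (Finset.univ.filter (fun x : F => x ^ 2 + x = r ^ 2 + r)).card = 2 := by
    intro r
    rw [hroots, Finset.card_pair]
    simp
  -- The map r ↦ r² + r is two-to-one onto its image, so twice the count is the number of triples
  -- (b, c, r) with r² + r = b c.
  have hfib : ∀ p : F × F, (∑ r : F, if r ^ 2 + r = p.1 * p.2 then 1 else 0) =
      if ∃ r : F, r ^ 2 + r = p.1 * p.2 then 2 else 0 := by
    intro p
    split_ifs with h
    · obtain ⟨r, hr⟩ := h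
      rw [← hr, ← Finset.sum_filter, ← Finset.card_eq_sum_ones, hroots_card]
    · push Not at h
      simp [h]
  -- For b ≠ 0, r determines c; for b = 0, r has two values and c is free.
  have hb : ∀ b : F, (∑ c : F, ∑ r : F, if r ^ 2 + r = b * c then 1 else 0) =
      Fintype.card F + if b = 0 then Fintype.card F else 0 := by
    intro b
    split_ifs with h
    · subst h
      have := hroots_card 0
      simp only [zero_mul, ← Finset.sum_filter, ← Finset.card_eq_sum_ones]
      rw [zero_pow two_ne_zero, zero_add] at this
      rw [this]
      simp
      ring
    · rw [Finset.sum_comm]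
      have : ∀ r c : F, (r ^ 2 + r = b * c) = (c = (r ^ 2 + r) / b) := fun r c => by
        rw [eq_div_iff h, mul_comm c b, eq_comm (a := b * c)]
      simp [this]
  have hsum : ∑ p : F × F, (∑ r : F, if r ^ 2 + r = p.1 * p.2 then 1 else 0) =
      Fintype.card F * (Fintype.card F + 1) := by
    rw [Fintype.sum_prod_type]
    simp only [hb]
    rw [Finset.sum_add_distrib]
    simp
    ring
  simp only [hfib] at hsum
  rw [Nat.card_eq_fintype_card, Nat.card_eq_fintype_card, ← hsum, Fintype.card_subtype,
    ← Finset.sum_filter, Finset.sum_const, smul_eq_mul, mul_comm]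

end CharTwo

/-! ### Centralizers in SL₂ and matrices modulo scalars. -/

namespace Matrix.SpecialLinearGroup

section Centralizer

variable {F : Type*} [Field F]

/-- The coordinates of a matrix modulo the scalar matrices, in characteristic two. -/
def coordModScalar (x : SpecialLinearGroup (Fin 2) F) : F × F × F :=
  (x.1 0 1, x.1 1 0, x.1 0 0 + x.1 1 1)

/-- Two vectors of the three-dimensional space are parallel. -/
def IsParallel (v w : F × F × F) : Prop :=
  v.1 * w.2.1 = v.2.1 * w.1 ∧ v.2.2 * w.1 = v.1 * w.2.2 ∧ v.2.2 * w.2.1 = v.2.1 * w.2.2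

theorem IsParallel.exists_eq_smul {v w : F × F × F} (h : IsParallel v w) (hv : v ≠ 0) :
    ∃ s : F, w = s • v := by
  obtain ⟨b, c, t⟩ := v
  obtain ⟨b', c', t'⟩ := w
  obtain ⟨h1, h2, h3⟩ := h
  simp only at h1 h2 h3
  by_cases hb : b = 0
  · by_cases hc : c = 0
    · have ht : t ≠ 0 := by
        rintro rfl
        exact hv (by rw [hb, hc]; rfl)
      refine ⟨t' / t, ?_⟩
      simp only [Prod.smul_mk, smul_eq_mul, Prod.mk.injEq]
      refine ⟨?_, ?_, ?_⟩ <;> field_simp <;> grind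
    · refine ⟨c' / c, ?_⟩
      simp only [Prod.smul_mk, smul_eq_mul, Prod.mk.injEq]
      refine ⟨?_, ?_, ?_⟩ <;> field_simp <;> grind
  · refine ⟨b' / b, ?_⟩
    simp only [Prod.smul_mk, smul_eq_mul, Prod.mk.injEq]
    refine ⟨?_, ?_, ?_⟩ <;> field_simp <;> grind

theorem isParallel_smul_iff {v w : F × F × F} {s : F} (hs : s ≠ 0) :
    IsParallel (s • v) w ↔ IsParallel v w := by
  simp only [IsParallel, Prod.smul_fst, Prod.smul_snd, smul_eq_mul, mul_assoc, mul_right_inj' hs]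

variable [CharP F 2]

/-- The entries of a commutator xy - yx are the 2×2 minors of the two coordinate vectors; the trace
serves as third coordinate because it equals the difference of the diagonal entries in
characteristic two. -/
theorem mem_centralizer_singleton_iff_isParallel (x y : SpecialLinearGroup (Fin 2) F) :
    y ∈ Subgroup.centralizer {x} ↔ IsParallel (coordModScalar x) (coordModScalar y) := by
  have h2 : (2 : F) = 0 := CharTwo.two_eq_zero
  rw [Subgroup.mem_centralizer_singleton_iff]
  simp only [Matrix.SpecialLinearGroup.ext_iff, Fin.forall_fin_two, coe_mul, Matrix.mul_apply,
    Fin.sum_univ_two, IsParallel, coordModScalar]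
  constructor
  · rintro ⟨⟨h00, h01⟩, h10, h11⟩
    refine ⟨?_, ?_, ?_⟩
    · linear_combination h11
    · linear_combination -h01 + (x.1 1 1 * y.1 0 1 - x.1 0 1 * y.1 1 1) * h2
    · linear_combination h10 + (x.1 1 1 * y.1 1 0 - x.1 1 0 * y.1 1 1) * h2
  · rintro ⟨h1, h3, h4⟩
    refine ⟨⟨?_, ?_⟩, ?_, ?_⟩
    · linear_combination -h1
    · linear_combination -h3 + (x.1 1 1 * y.1 0 1 - x.1 0 1 * y.1 1 1) * h2
    · linear_combination h4 - (x.1 1 1 * y.1 1 0 - x.1 1 0 * y.1 1 1) * h2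
    · linear_combination h1

theorem coordModScalar_eq_zero_iff {x : SpecialLinearGroup (Fin 2) F} :
    coordModScalar x = 0 ↔ x = 1 := by
  have h2 : (2 : F) = 0 := CharTwo.two_eq_zero
  constructor
  · intro h
    have h01 : x.1 0 1 = 0 := congrArg Prod.fst h
    have h10 : x.1 1 0 = 0 := congrArg (fun v => v.2.1) h
    have ht : x.1 0 0 + x.1 1 1 = 0 := congrArg (fun v => v.2.2) h
    have hd := x.2
    rw [Matrix.det_fin_two, h01, h10] at hd
    have h11 : x.1 1 1 = 1 := by
      refine sq_inj_of_charTwo ?_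
      linear_combination hd - x.1 1 1 * ht + (x.1 1 1) ^ 2 * h2
    have h00 : x.1 0 0 = 1 := by linear_combination ht - h11 - h2
    ext i j
    fin_cases i <;> fin_cases j <;> simp [h01, h10, h11, h00]
  · rintro rfl
    simp [coordModScalar, CharTwo.add_self_eq_zero]

/-- Every direction is the class of an element of `SL₂` modulo scalar matrices. -/
theorem exists_coordModScalar_eq_smul [Fintype F] (hF : 2 < Fintype.card F) (v : F × F × F) :
    ∃ x : SpecialLinearGroup (Fin 2) F, ∃ s : F, s ≠ 0 ∧ coordModScalar x = s • v := by
  classical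
  obtain ⟨b, c, t⟩ := v
  have h2 : (2 : F) = 0 := CharTwo.two_eq_zero
  -- Adding the scalar z to a representative of v gives this determinant. It has at most two roots
  -- in z, and a square root of its inverse rescales the matrix into SL₂.
  obtain ⟨z, hz⟩ : ∃ z : F, z ^ 2 + z * t - b * c ≠ 0 := by
    by_contra! hcon
    let p : Polynomial F := Polynomial.C 1 * Polynomial.X ^ 2 + Polynomial.C t * Polynomial.X +
      Polynomial.C (-(b * c))
    have hdeg : p.natDegree = 2 := Polynomial.natDegree_quadratic one_ne_zero
    have hle : (Finset.univ : Finset F).card ≤ p.natDegree :=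
      Polynomial.card_le_degree_of_subset_roots fun z _ => by
        rw [Polynomial.mem_roots (Polynomial.ne_zero_of_natDegree_gt (n := 1) (by omega)),
          Polynomial.IsRoot.def]
        simp only [p, Polynomial.eval_add, Polynomial.eval_mul, Polynomial.eval_pow,
          Polynomial.eval_C, Polynomial.eval_X]
        linear_combination hcon z
    rw [Finset.card_univ] at hle
    omega
  obtain ⟨s, hs⟩ := exists_sq_eq_of_charTwo (z ^ 2 + z * t - b * c)⁻¹
  have hs0 : s ≠ 0 := by
    rintro rfl
    exact inv_ne_zero hz (by simpa using hs.symm)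
  refine ⟨⟨!![s * (z + t), s * b; s * c, s * z], ?_⟩, s, hs0, ?_⟩
  · rw [Matrix.det_fin_two_of]
    calc s * (z + t) * (s * z) - s * b * (s * c) = s ^ 2 * (z ^ 2 + z * t - b * c) := by ring
      _ = 1 := by rw [hs, inv_mul_cancel₀ hz]
  · simp only [coordModScalar, Prod.smul_mk, smul_eq_mul]
    refine Prod.ext (by simp) (Prod.ext (by simp) ?_)
    simp only [Matrix.of_apply, Matrix.cons_val]
    linear_combination s * z * h2

/-- The centralizer of `x` consists of the matrices of determinant one in the algebra that `x`
spans together with the scalar matrices. -/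
theorem card_centralizer_of_coordModScalar_eq_smul {x : SpecialLinearGroup (Fin 2) F} {b c t s : F}
    (hs : s ≠ 0) (hv : (b, c, t) ≠ 0) (hx : coordModScalar x = s • (b, c, t)) :
    Nat.card (Subgroup.centralizer {x}) =
      Nat.card {v : F × F // v.1 ^ 2 + v.1 * v.2 * t + v.2 ^ 2 * (b * c) = 1} := by
  have h2 : (2 : F) = 0 := CharTwo.two_eq_zero
  have hmem : ∀ y, y ∈ Subgroup.centralizer {x} ↔ IsParallel (b, c, t) (coordModScalar y) :=
    fun y => by rw [mem_centralizer_singleton_iff_isParallel, hx, isParallel_smul_iff hs]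
  symm
  -- The pair (a, r) encodes a plus r times the matrix with rows (t, b) and (c, 0).
  refine Nat.card_congr (Equiv.ofBijective
    (fun v => ⟨⟨!![v.1.1 + v.1.2 * t, v.1.2 * b; v.1.2 * c, v.1.1], ?_⟩, ?_⟩) ⟨?_, ?_⟩)
  · rw [Matrix.det_fin_two_of]
    linear_combination v.2 - v.1.2 ^ 2 * b * c * h2
  · refine (hmem _).2 ?_
    simp only [IsParallel, coordModScalar, Matrix.of_apply, Matrix.cons_val]
    refine ⟨by ring, ?_, ?_⟩
    · linear_combination -b * v.1.1 * h2
    · linear_combination -c * v.1.1 * h2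
  · rintro ⟨⟨a, r⟩, h⟩ ⟨⟨a', r'⟩, h'⟩ heq
    have heq' := congrArg (fun g => g.1.1) heq
    have e11 : a = a' := congrFun (congrFun heq' 1) 1
    have e00 : a + r * t = a' + r' * t := congrFun (congrFun heq' 0) 0
    have e01 : r * b = r' * b := congrFun (congrFun heq' 0) 1
    have e10 : r * c = r' * c := congrFun (congrFun heq' 1) 0
    have hr : r = r' := by
      by_contra hne
      have hne' := sub_ne_zero.2 hne
      refine hv (Prod.ext ?_ (Prod.ext ?_ ?_)) <;> refine (mul_eq_zero.1 ?_).resolve_left hne'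
      · linear_combination e01
      · linear_combination e10
      · linear_combination e00 - e11
    subst e11 hr
    rfl
  · rintro ⟨y, hy⟩
    obtain ⟨r, hr⟩ := ((hmem y).1 hy).exists_eq_smul hv
    have h01 : y.1 0 1 = r * b := congrArg Prod.fst hr
    have h10 : y.1 1 0 = r * c := congrArg (fun v => v.2.1) hr
    have ht : y.1 0 0 + y.1 1 1 = r * t := congrArg (fun v => v.2.2) hr
    have h00 : y.1 0 0 = y.1 1 1 + r * t := by linear_combination ht - y.1 1 1 * h2
    have hd := y.2
    rw [Matrix.det_fin_two, h01, h10, h00] at hd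
    refine ⟨⟨(y.1 1 1, r), ?_⟩, ?_⟩
    · linear_combination hd + r ^ 2 * b * c * h2
    · refine Subtype.ext (Subtype.ext ?_)
      simp only
      rw [← h00, ← h01, ← h10]
      exact (Matrix.eta_fin_two _).symm

end Centralizer

/-- Homogeneous coordinates of the points of the projective plane: a point at infinity, or a point
of the affine plane. -/
def planeCoord {F : Type*} [Field F] : Option F ⊕ F × F → F × F × F
  | Sum.inl none => (0, 1, 0)
  | Sum.inl (some c) => (1, c, 0)
  | Sum.inr (b, c) => (b, c, 1)

theorem planeCoord_ne_zero {F : Type*} [Field F] (p : Option F ⊕ F × F) : planeCoord p ≠ 0 := by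
  rcases p with (_ | c) | ⟨b, c⟩ <;> simp [planeCoord, Prod.ext_iff]

theorem exists_eq_smul_planeCoord {F : Type*} [Field F] (v : F × F × F) (hv : v ≠ 0) :
    ∃ p, ∃ s : F, v = s • planeCoord p := by
  obtain ⟨b, c, t⟩ := v
  by_cases ht : t = 0
  · by_cases hb : b = 0
    · exact ⟨Sum.inl none, c, by simp [planeCoord, ht, hb]⟩
    · exact ⟨Sum.inl (some (c / b)), b, by simp [planeCoord, ht, mul_div_cancel₀ _ hb]⟩
  · exact ⟨Sum.inr (b / t, c / t), t, by simp [planeCoord, mul_div_cancel₀ _ ht]⟩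

theorem eq_of_smul_planeCoord_eq {F : Type*} [Field F] {p p' : Option F ⊕ F × F} {s s' : F}
    (hs : s ≠ 0) (h : s • planeCoord p = s' • planeCoord p') : p = p' := by
  rcases p with (_ | c) | ⟨b, c⟩ <;> rcases p' with (_ | c') | ⟨b', c'⟩ <;>
    simp only [planeCoord, Prod.smul_mk, smul_eq_mul, Prod.mk.injEq] at h <;> grind

end Matrix.SpecialLinearGroup

/-! ### Proper centralizers as points of the projective plane, by type. -/

namespace Matrix.SpecialLinearGroup

variable {F : Type*} [Field F]

theorem centralizer_ne_top_of_ne_one [CharP F 2] {x : SpecialLinearGroup (Fin 2) F} (hx : x ≠ 1) :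
    Subgroup.centralizer {x} ≠ ⊤ := by
  intro h
  have hpar : ∀ y, IsParallel (coordModScalar x) (coordModScalar y) := fun y => by
    rw [← mem_centralizer_singleton_iff_isParallel, h]
    trivial
  obtain ⟨h1, h2, -⟩ := hpar ⟨!![1, 1; 0, 1], by simp⟩
  obtain ⟨h3, -, -⟩ := hpar ⟨!![1, 0; 1, 1], by simp⟩
  refine hx (coordModScalar_eq_zero_iff.1 ?_)
  simp only [coordModScalar, of_apply, cons_val, mul_zero, mul_one, CharTwo.add_self_eq_zero]
    at h1 h2 h3
  exact Prod.ext h3 (Prod.ext h1.symm h2)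

/-- The proper centralizers of `SL₂` in characteristic two correspond to the points of the
projective plane of matrices modulo scalar matrices. -/
theorem exists_equiv_properCentralizer [CharP F 2] [Fintype F] (hF : 2 < Fintype.card F) :
    ∃ e : (Option F ⊕ F × F) ≃ ProperCentralizer (SpecialLinearGroup (Fin 2) F),
      ∀ p, ∃ x, ∃ s : F, s ≠ 0 ∧ coordModScalar x = s • planeCoord p ∧
        (e p).1 = Subgroup.centralizer {x} := by
  choose x s hs hx using fun p : Option F ⊕ F × F =>
    exists_coordModScalar_eq_smul hF (planeCoord p)
  have hx1 : ∀ p, x p ≠ 1 := fun p h => by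
    rw [← coordModScalar_eq_zero_iff, hx] at h
    exact smul_ne_zero (hs p) (planeCoord_ne_zero p) h
  have hmem : ∀ p y, y ∈ Subgroup.centralizer {x p} ↔
      IsParallel (planeCoord p) (coordModScalar y) := fun p y => by
    rw [mem_centralizer_singleton_iff_isParallel, hx, isParallel_smul_iff (hs p)]
  refine ⟨Equiv.ofBijective (fun p => ⟨Subgroup.centralizer {x p},
    centralizer_ne_top_of_ne_one (hx1 p), x p, rfl⟩) ⟨?_, ?_⟩, fun p => ⟨x p, s p, hs p, hx p, rfl⟩⟩
  · intro p p' h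
    have h' : Subgroup.centralizer {x p} = Subgroup.centralizer {x p'} := congrArg Subtype.val h
    -- Since x p lies in its own centralizer, equality of centralizers makes it parallel to the
    -- point p'.
    have hself : x p ∈ Subgroup.centralizer {x p} :=
      Subgroup.mem_centralizer_singleton_iff.2 rfl
    rw [h', hmem] at hself
    obtain ⟨r, hr⟩ := hself.exists_eq_smul (planeCoord_ne_zero p')
    exact eq_of_smul_planeCoord_eq (hs p) ((hx p).symm.trans hr)
  · rintro ⟨_, hH, y, rfl⟩
    have hy : y ≠ 1 := by
      rintro rfl
      refine hH (eq_top_iff.2 fun g _ => ?_)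
      simp [Subgroup.mem_centralizer_singleton_iff]
    have hy0 : coordModScalar y ≠ 0 := fun h => hy (coordModScalar_eq_zero_iff.1 h)
    obtain ⟨p, r, hr⟩ := exists_eq_smul_planeCoord (coordModScalar y) hy0
    have hr0 : r ≠ 0 := by
      rintro rfl
      exact hy0 (by rw [hr, zero_smul])
    refine ⟨p, Subtype.ext (Subgroup.ext fun g => ?_)⟩
    refine (hmem p g).trans ?_
    rw [← isParallel_smul_iff hr0, ← hr, mem_centralizer_singleton_iff_isParallel]

open Classical in
/-- The type of a point of the projective plane: unipotent, split or non-split. -/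
noncomputable def planeType : Option F ⊕ F × F → Fin 3
  | Sum.inl _ => 0
  | Sum.inr v => if ∃ r : F, r ^ 2 + r = v.1 * v.2 then 1 else 2

/-- Points at infinity have trace zero, hence an inseparable form; at (b, c, 1) the form splits
exactly when b c = r² + r is solvable. -/
theorem card_centralizer_eq [CharP F 2] [Fintype F] {x : SpecialLinearGroup (Fin 2) F} {p : Option F ⊕ F × F} {s : F}
    (hs : s ≠ 0) (hx : coordModScalar x = s • planeCoord p) :
    Nat.card (Subgroup.centralizer {x}) =
      ![Nat.card F, Nat.card F - 1, Nat.card F + 1] (planeType p) := by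
  rw [card_centralizer_of_coordModScalar_eq_smul hs (planeCoord_ne_zero p) hx]
  rcases p with (_ | c) | ⟨b, c⟩
  · simpa [planeCoord, planeType] using card_inseparable_norm_one (0 * 1 : F)
  · simpa [planeCoord, planeType] using card_inseparable_norm_one (1 * c : F)
  · simp only [planeType, mul_one]
    split_ifs with h
    · obtain ⟨r, hr⟩ := h
      rw [← hr]
      exact card_split_norm_one r
    · exact card_anisotropic_norm_one _ fun r hr => h ⟨r, hr⟩

theorem card_planeType_eq_zero [Fintype F] :
    Nat.card {p : Option F ⊕ F × F // planeType p = 0} = Nat.card F + 1 := by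
  rw [← Finite.card_option]
  refine (Nat.card_congr (Equiv.ofBijective (fun o => ⟨Sum.inl o, rfl⟩) ⟨?_, ?_⟩)).symm
  · intro o o' h
    exact Sum.inl_injective (congrArg Subtype.val h)
  · rintro ⟨o | v, h⟩
    · exact ⟨o, rfl⟩
    · simp only [planeType] at h
      split_ifs at h <;> simp at h

theorem two_mul_card_planeType_eq_one [CharP F 2] [Fintype F] :
    2 * Nat.card {p : Option F ⊕ F × F // planeType p = 1} = Nat.card F * (Nat.card F + 1) := by
  rw [← two_mul_card_mul_eq_sq_add_self]
  congr 1
  refine (Nat.card_congr (Equiv.ofBijective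
    (fun v => ⟨Sum.inr v.1, by simp [planeType, v.2]⟩) ⟨?_, ?_⟩)).symm
  · intro v v' h
    simpa [Subtype.ext_iff] using h
  · rintro ⟨o | v, h⟩
    · simp [planeType] at h
    · simp only [planeType] at h
      split_ifs at h with hv
      · exact ⟨⟨v, hv⟩, rfl⟩
      · simp at h

/-- Yields the number of non-split points by subtraction. -/
theorem card_planeType_add [Fintype F] :
    Nat.card {p : Option F ⊕ F × F // planeType p = 0} +
      Nat.card {p : Option F ⊕ F × F // planeType p = 1} +
      Nat.card {p : Option F ⊕ F × F // planeType p = 2} =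
      Nat.card F + 1 + Nat.card F * Nat.card F := by
  classical
  have h : Fintype.card (Option F ⊕ F × F) = _ :=
    Fintype.card_congr (Equiv.sigmaFiberEquiv (planeType (F := F))).symm
  rw [Fintype.card_sigma, Fin.sum_univ_three] at h
  simp only [Nat.card_eq_fintype_card]
  rw [← h]
  simp

end Matrix.SpecialLinearGroup

/-! ### Transfer to PSL₂ and the final computation. -/

/-- Isomorphic groups have the same proper centralizers. -/
theorem exists_properCentralizer_equiv {G G' : Type*} [Group G] [Group G'] (e : G ≃* G') :
    ∃ f : ProperCentralizer G ≃ ProperCentralizer G',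
      ∀ H, Nat.card (f H).1 = Nat.card H.1 := by
  have hmap : ∀ x, e.mapSubgroup (Subgroup.centralizer {x}) = Subgroup.centralizer {e x} := by
    intro x
    ext y
    obtain ⟨z, rfl⟩ := e.surjective y
    simp [Subgroup.mem_centralizer_singleton_iff, ← map_mul]
  refine ⟨Equiv.subtypeEquiv e.mapSubgroup.toEquiv fun H => and_congr ?_ ?_, fun H => ?_⟩
  · exact not_congr (map_eq_top_iff (f := e.mapSubgroup)).symm
  · refine ⟨fun ⟨x, hx⟩ => ⟨e x, hx ▸ hmap x⟩, fun ⟨y, hy⟩ => ⟨e.symm y, ?_⟩⟩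
    refine e.mapSubgroup.injective ?_
    rw [hmap, e.apply_symm_apply]
    exact hy
  · exact Nat.card_congr (e.subgroupMap H.1).symm.toEquiv

/-- In characteristic two, `PSL₂` is `SL₂`. -/
theorem Matrix.ProjectiveSpecialLinearGroup.nonempty_mulEquiv {F : Type*} [Field F] [CharP F 2] :
    Nonempty (Matrix.ProjectiveSpecialLinearGroup (Fin 2) F ≃*
      Matrix.SpecialLinearGroup (Fin 2) F) := by
  have hbot : Subgroup.center (Matrix.SpecialLinearGroup (Fin 2) F) = ⊥ := by
    refine (Subgroup.eq_bot_iff_forall _).2 fun x hx => ?_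
    by_contra h
    refine Matrix.SpecialLinearGroup.centralizer_ne_top_of_ne_one h (eq_top_iff.2 fun y _ => ?_)
    exact Subgroup.mem_centralizer_singleton_iff.2 (Subgroup.mem_center_iff.1 hx y)
  exact ⟨(QuotientGroup.quotientMulEquivOfEq hbot).trans QuotientGroup.quotientBot⟩

theorem nonempty_iso_completeMultipartiteGraph {V ι : Type*} [Finite V] {H : SimpleGraph V}
    {τ : V → ι} {n : ι → ℕ} (hadj : ∀ u v, H.Adj u v ↔ τ u ≠ τ v)
    (hn : ∀ i, Nat.card {v // τ v = i} = n i) :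
    Nonempty (H ≃g SimpleGraph.completeMultipartiteGraph fun i => Fin (n i)) := by
  refine ⟨⟨(Equiv.sigmaFiberEquiv τ).symm.trans
    (Equiv.sigmaCongrRight fun i => Finite.equivFinOfCardEq (hn i)), ?_⟩⟩
  intro u v
  rw [hadj]
  rfl

open Matrix.SpecialLinearGroup in
/-- The proper centralizers of `PSL₂(2 ^ k)`, classified by their order. -/
theorem exists_type_properCentralizer_psl {k : ℕ} (hk : 2 ≤ k) {F : Type*} [Field F] [Fintype F]
    (hF : Fintype.card F = 2 ^ k) :
    ∃ τ : ProperCentralizer (Matrix.ProjectiveSpecialLinearGroup (Fin 2) F) → Fin 3,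
      (∀ u v, Nat.card u.1 = Nat.card v.1 ↔ τ u = τ v) ∧
      ∀ i, Nat.card {v // τ v = i} =
        ![2 ^ k + 1, 2 ^ (k - 1) * (2 ^ k + 1), 2 ^ (k - 1) * (2 ^ k - 1)] i := by
  have : CharP F 2 := by
    have := Fact.mk Nat.prime_two
    exact charP_of_card_eq_prime_pow hF
  obtain ⟨m, rfl⟩ : ∃ m, k = m + 1 := ⟨k - 1, by omega⟩
  have hm : 2 ≤ 2 ^ m := Nat.le_self_pow (by omega) 2
  have hq : Nat.card F = 2 * 2 ^ m := by rw [Nat.card_eq_fintype_card, hF, pow_succ, mul_comm]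
  have hcard : 2 < Fintype.card F := by rw [hF, pow_succ]; omega
  obtain ⟨e, he⟩ := exists_equiv_properCentralizer hcard
  obtain ⟨E⟩ := Matrix.ProjectiveSpecialLinearGroup.nonempty_mulEquiv (F := F)
  obtain ⟨f, hf⟩ := exists_properCentralizer_equiv E
  have hv : ∀ v, Nat.card v.1 = ![Nat.card F, Nat.card F - 1, Nat.card F + 1]
      (planeType (e.symm (f v))) := by
    intro v
    obtain ⟨x, s, hs, hx, hH⟩ := he (e.symm (f v))
    rw [← card_centralizer_eq hs hx, ← hH, e.apply_symm_apply, hf]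
  have hinj : Function.Injective ![Nat.card F, Nat.card F - 1, Nat.card F + 1] := by
    rw [hq]
    intro i j h
    fin_cases i <;> fin_cases j <;> simp at h ⊢ <;> omega
  refine ⟨fun v => planeType (e.symm (f v)), fun u v => ?_, fun i => ?_⟩
  · rw [hv u, hv v, hinj.eq_iff]
  · refine (Nat.card_congr ((f.trans e.symm).subtypeEquiv (q := fun p => planeType p = i)
      fun v => Iff.rfl)).trans ?_
    have h0 := card_planeType_eq_zero (F := F)
    have h1 := two_mul_card_planeType_eq_one (F := F)
    have hadd := card_planeType_add (F := F)
    rw [h0] at hadd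
    rw [hq] at h0 h1 hadd
    have hp : 2 ^ (m + 1) = 2 * 2 ^ m := by rw [pow_succ, mul_comm]
    rw [hp, Nat.add_sub_cancel]
    generalize 2 ^ m = a at *
    obtain ⟨b, hb⟩ : ∃ b, 2 * a = b + 1 := ⟨2 * a - 1, by omega⟩
    fin_cases i
    · exact h0
    · change Nat.card {p : Option F ⊕ F × F // planeType p = 1} = a * (2 * a + 1)
      linarith
    · change Nat.card {p : Option F ⊕ F × F // planeType p = 2} = a * (2 * a - 1)
      have hab : a * (2 * a) = a * (b + 1) := by rw [hb]
      rw [show 2 * a - 1 = b by omega]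
      linarith

theorem coCentralizerGraph_adj_iff {G : Type*} [Group G] (u v : ProperCentralizer G) :
    (coCentralizerGraph G).Adj u v ↔ Nat.card u.1 ≠ Nat.card v.1 := by
  rw [coCentralizerGraph, SimpleGraph.compl_adj, centralizerGraph]
  refine ⟨fun h hc => h.2 ⟨h.1, hc⟩, fun h => ⟨?_, fun hc => h hc.2⟩⟩
  rintro rfl
  exact h rfl

theorem mainTheorem1 (k : ℕ) (hk : 2 ≤ k) (F : Type*) [Field F] [Fintype F]
    (hF : Fintype.card F = 2 ^ k) :
    Nonempty (coCentralizerGraph (Matrix.ProjectiveSpecialLinearGroup (Fin 2) F) ≃g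
      SimpleGraph.completeMultipartiteGraph (fun i : Fin 3 =>
        Fin (![2 ^ k + 1, 2 ^ (k - 1) * (2 ^ k + 1), 2 ^ (k - 1) * (2 ^ k - 1)] i))) ∧
    (coCentralizerGraph (Matrix.ProjectiveSpecialLinearGroup (Fin 2) F)).distLaplacianSpectrum =
      Multiset.replicate 1 (0 : ℝ) +
      Multiset.replicate (2 ^ (k - 1) * (2 ^ k + 1) - 1)
        (3 * 2 ^ (2 * k - 1) + 3 * 2 ^ (k - 1) + 1 : ℝ) +
      Multiset.replicate (2 ^ (k - 1) * (2 ^ k - 1) - 1)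
        (3 * 2 ^ (2 * k - 1) + 2 ^ (k - 1) + 1 : ℝ) +
      Multiset.replicate (2 ^ k) (2 ^ (2 * k) + 2 ^ (k + 1) + 2 : ℝ) +
      Multiset.replicate 2 (2 ^ (2 * k) + 2 ^ k + 1 : ℝ) ∧
    ([0, 3 * 2 ^ (2 * k - 1) + 3 * 2 ^ (k - 1) + 1, 3 * 2 ^ (2 * k - 1) + 2 ^ (k - 1) + 1,
      2 ^ (2 * k) + 2 ^ (k + 1) + 2, 2 ^ (2 * k) + 2 ^ k + 1] : List ℝ).Nodup ∧
    (coCentralizerGraph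
      (Matrix.ProjectiveSpecialLinearGroup (Fin 2) F)).IsDistLaplacianIntegral := by
  obtain ⟨τ, hτ, hn⟩ := exists_type_properCentralizer_psl hk hF
  have hadj : ∀ u v, (coCentralizerGraph (Matrix.ProjectiveSpecialLinearGroup (Fin 2) F)).Adj u v ↔
      τ u ≠ τ v := fun u v => by rw [coCentralizerGraph_adj_iff, Ne, hτ]
  have hspec : (coCentralizerGraph
        (Matrix.ProjectiveSpecialLinearGroup (Fin 2) F)).distLaplacianSpectrum =
      Multiset.replicate 1 (0 : ℝ) +
      Multiset.replicate (2 ^ (k - 1) * (2 ^ k + 1) - 1)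
        (3 * 2 ^ (2 * k - 1) + 3 * 2 ^ (k - 1) + 1 : ℝ) +
      Multiset.replicate (2 ^ (k - 1) * (2 ^ k - 1) - 1)
        (3 * 2 ^ (2 * k - 1) + 2 ^ (k - 1) + 1 : ℝ) +
      Multiset.replicate (2 ^ k) (2 ^ (2 * k) + 2 ^ (k + 1) + 2 : ℝ) +
      Multiset.replicate 2 (2 ^ (2 * k) + 2 ^ k + 1 : ℝ) := by
    have hsurj : Function.Surjective τ := fun i => by
      have hpos : 0 < Nat.card {v // τ v = i} := by
        have h1 : 1 < 2 ^ k := Nat.one_lt_two_pow (by omega)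
        have h2 : 0 < 2 ^ (k - 1) := by positivity
        rw [hn i]
        fin_cases i
        · exact Nat.succ_pos _
        · exact Nat.mul_pos h2 (Nat.succ_pos _)
        · exact Nat.mul_pos h2 (Nat.sub_pos_of_lt h1)
      obtain ⟨⟨v, hv⟩⟩ := (Nat.card_pos_iff.1 hpos).1
      exact ⟨v, hv⟩
    rw [SimpleGraph.distLaplacianSpectrum_of_adj_iff_ne hadj hsurj
      (n := ![2 ^ k + 1, 2 ^ (k - 1) * (2 ^ k + 1), 2 ^ (k - 1) * (2 ^ k - 1)])
      fun i => by rw [← Nat.card_eq_fintype_card, hn]]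
    simp only [Matrix.cons_val]
    obtain ⟨m, rfl⟩ : ∃ m, k = m + 1 := ⟨k - 1, by omega⟩
    have e1 : 2 * (m + 1) - 1 = m * 2 + 1 := by omega
    rw [Nat.add_sub_cancel, Nat.add_sub_cancel, e1]
    push_cast [Nat.one_le_two_pow]
    refine congrArg₂ _ (congrArg₂ _ (congrArg₂ _ (congrArg₂ _ rfl ?_) ?_) ?_) ?_ <;>
      exact congrArg _ (by ring)
  refine ⟨nonempty_iso_completeMultipartiteGraph hadj hn, hspec, ?_, ?_⟩
  · obtain ⟨m, rfl⟩ : ∃ m, k = m + 1 := ⟨k - 1, by omega⟩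
    have e1 : 2 * (m + 1) - 1 = m * 2 + 1 := by omega
    have e2 : 2 * (m + 1) = m * 2 + 2 := by omega
    have hm : (2 : ℝ) ≤ 2 ^ m := by
      calc (2 : ℝ) = 2 ^ 1 := by norm_num
        _ ≤ 2 ^ m := pow_le_pow_right₀ (by norm_num) (by omega)
    rw [e1, e2, Nat.add_sub_cancel]
    simp only [pow_add, pow_mul]
    generalize (2 : ℝ) ^ m = a at *
    simp only [List.nodup_cons, List.mem_cons, List.not_mem_nil, or_false, not_or,
      not_false_eq_true, List.nodup_nil, and_true]
    -- Here a = q/2, at least 2. Eigenvalues (c) and (d) differ by 2a² - 3a - 1, which is only 1 at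
    -- a = 2.
    refine ⟨⟨?_, ?_, ?_, ?_⟩, ⟨?_, ?_, ?_⟩, ⟨?_, ?_⟩, ?_⟩ <;> intro h <;> nlinarith
  · intro μ hμ
    rw [hspec] at hμ
    simp only [Multiset.mem_add, Multiset.mem_replicate] at hμ
    rcases hμ with (((⟨-, rfl⟩ | ⟨-, rfl⟩) | ⟨-, rfl⟩) | ⟨-, rfl⟩) | ⟨-, rfl⟩
    · exact ⟨0, by norm_num⟩
    · exact ⟨3 * 2 ^ (2 * k - 1) + 3 * 2 ^ (k - 1) + 1, by push_cast; rfl⟩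
    · exact ⟨3 * 2 ^ (2 * k - 1) + 2 ^ (k - 1) + 1, by push_cast; rfl⟩
    · exact ⟨2 ^ (2 * k) + 2 ^ (k + 1) + 2, by push_cast; rfl⟩
    · exact ⟨2 ^ (2 * k) + 2 ^ k + 1, by push_cast; rfl⟩
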